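/- \textbf{Setting.} Let $E$ be a locally compact Hausdorff space with a countable base, with its Borel $\sigma$-algebra, and let $\Omega$ be the set of continuous maps $\omega:[0,\infty)\to E$, with the compact-open topology and the $\sigma$-algebra generated by the coordinate maps $X_t(\omega)=\omega(t)$ (which is its Borel $\sigma$-algebra). Let $(\hat P_t)_{t\ge 0}$ be an honest Feller--Dynkin semigroup on $C_0(E)$: a strongly continuous semigroup of bounded linear operators such that $0\le f\le 1$ implies $0\le \hat P_t f\le 1$, and whose representing kernels, given by $\hat P_tf(x)=\int f\,\mathrm{d}P_t(x)$ for $f \in C_0(E)$, are Markov kernels. Assume that it defines a diffusion: for each $x\in E$ there is a probability measure $\mathbb P^x$ on $\Omega$ with $$\mathbb P^x(X_0\in dx_0,X_{t_1}\in dx_1,\dots,X_{t_n}\in dx_n)=\delta_x(dx_0)P_{t_1}(x_0,dx_1)\cdots P_{t_n-t_{n-1}}(x_{n-1},dx_n)$$ for all $n \ge 0$ and $0<t_1<\dots<t_n$, and $x\mapsto\mathbb P^x$ is weakly continuous. Let $obs:E\to[0,1]$ be continuous and let $0<c<1$. \textbf{The functional.} For a lower semi-continuous pseudometric $m:E\times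 E\to[0,1]$ put $$U_c(m)(\omega,\omega')=\sup_{t\ge 0}c^t\,m(\omega(t),\omega'(t)),\qquad \mathcal G_c(m)(x,y)=\inf_{\gamma\in\Gamma(\mathbb P^x,\mathbb P^y)}\int U_c(m)\,\mathrm{d}\gamma ,$$ where $\Gamma(\mu,\nu)$ is the set of couplings of $\mu$ and $\nu$ (probability measures on $\Omega\times\Omega$ with marginals $\mu$ and $\nu$). \textbf{The logic.} State expressions $f\in\mathcal L_\sigma$ and trajectory expressions $g\in\mathcal L_\tau$ are defined by mutual induction: $$f ::= q\mid obs\mid 1-f\mid \textstyle\int g,\qquad g ::= f\circ ev_t\mid \min\{g_1,g_2\}\mid\max\{g_1,g_2\}\mid g\ominus q\mid g\oplus q,$$ with $q\in\mathbb Q\cap[0,1]$ and $t\in\mathbb Q_{\ge 0}$. They are interpreted as functions $E\to[0,1]$ and $\Omega\to[0,1]$ by $q(x)=q$, $obs(x)=obs(x)$, $(1-f)(x)=1-f(x)$, $(\int g)(x)=\int g\,\mathrm{d}\mathbb P^x$, $(f\circ ev_t)(\omega)=c^tf(\omega(t))$, pointwise $\min$ and $\max$, $(g\ominus q)(\omega)=\max\{0,g(\omega)-q\}$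 and $(g\oplus q)(\omega)=\min\{1,g(\omega)+q\}$. Define $$\ell^c(x,y)=\sup_{f\in\mathcal L_\sigma}|f(x)-f(y)|,\qquad x,y\in E.$$ \textbf{Theorem.} $\ell^c$ is a lower semi-continuous pseudometric on $E$ with values in $[0,1]$, and it is a fixpoint of $\mathcal G_c$: $\mathcal G_c(\ell^c)=\ell^c$. Moreover, for all $x,y\in E$ the infimum defining $\mathcal G_c(\ell^c)(x,y)$ is attained. -/

import Mathlib

open MeasureTheory ProbabilityTheory Filter Set
open scoped NNReal ENNReal Topology ZeroAtInfty unitInterval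

namespace DiffusionLogic

/-! ### Trajectories -/

/-- The trajectory space `Ω` of all continuous maps `[0, ∞) → E`, with the compact-open topology
(locally uniform convergence). -/
abbrev Trajectory (E : Type*) [TopologicalSpace E] := C(ℝ≥0, E)

/-- The `σ`-algebra `𝒜 = σ(X_s | s ≥ 0)` on `Ω` generated by the coordinate maps
`X_s ω = ω s`. -/
instance trajectoryMeasurableSpace (E : Type*) [TopologicalSpace E] [MeasurableSpace E] :
    MeasurableSpace (Trajectory E) :=
  ⨆ s : ℝ≥0, MeasurableSpace.comap (fun ω : Trajectory E => ω s) inferInstance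

theorem measurable_coord {E : Type*} [TopologicalSpace E] [MeasurableSpace E] (s : ℝ≥0) :
    Measurable (fun ω : Trajectory E => ω s) := by
  rw [measurable_iff_comap_le]
  exact le_iSup (fun s : ℝ≥0 =>
    MeasurableSpace.comap (fun ω : Trajectory E => ω s) inferInstance) s

/-- The `σ`-algebra generated by the coordinate maps is the Borel `σ`-algebra of `Ω`. -/
instance trajectoryBorelSpace (E : Type*) [TopologicalSpace E] [LocallyCompactSpace E]
    [T2Space E] [SecondCountableTopology E] [MeasurableSpace E] [BorelSpace E] :
    BorelSpace (Trajectory E) := by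
  constructor
  apply le_antisymm
  · refine iSup_le fun s => ?_
    rw [← measurable_iff_comap_le]
    have hc : Continuous (fun ω : Trajectory E => ω s) := continuous_eval_const s
    exact @Continuous.measurable _ _ _ (borel (Trajectory E))
      (@OpensMeasurableSpace.mk _ _ (borel (Trajectory E)) le_rfl) _ _ _ _ hc
  · have hsub := borel_eq_generateFrom_of_subbasis
      (ContinuousMap.compactOpen_eq (X := ℝ≥0) (Y := E))
    rw [hsub]
    refine MeasurableSpace.generateFrom_le ?_
    rintro _ ⟨K, hK, U, hU, rfl⟩
    let _ : MetricSpace E := TopologicalSpace.metrizableSpaceMetric E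
    obtain ⟨D, hDc, hDd⟩ := TopologicalSpace.exists_countable_dense K
    have key : {ω : Trajectory E | MapsTo ω K U} =
        ⋃ n : ℕ, ⋂ q ∈ D, (fun ω : Trajectory E => ω q.1) ⁻¹'
          {z | ((n : ℝ≥0∞))⁻¹ ≤ Metric.infEDist z Uᶜ} := by
      ext ω
      simp only [mem_ofPred_eq, mem_iUnion, mem_iInter, mem_preimage]
      constructor
      · intro h
        have hpos : ∀ t ∈ K, 0 < Metric.infEDist (ω t) Uᶜ := fun t ht => by
          rw [Metric.infEDist_pos_iff_notMem_closure, hU.isClosed_compl.closure_eq]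
          exact fun h' => h' (h ht)
        obtain ⟨n, hn⟩ : ∃ n : ℕ, ∀ t ∈ K, ((n : ℝ≥0∞))⁻¹ ≤ Metric.infEDist (ω t) Uᶜ := by
          rcases K.eq_empty_or_nonempty with rfl | hne
          · exact ⟨0, by simp⟩
          · obtain ⟨t₀, ht₀, hmin⟩ := IsCompact.exists_isMinOn hK hne
              (f := fun t => Metric.infEDist (ω t) Uᶜ)
              (Metric.continuous_infEDist.comp ω.continuous).continuousOn
            obtain ⟨n, hn⟩ := ENNReal.exists_inv_nat_lt (hpos t₀ ht₀).ne'
            exact ⟨n, fun t ht => hn.le.trans (hmin ht)⟩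
        exact ⟨n, fun q _ => hn q.1 q.2⟩
      · rintro ⟨n, hn⟩ t ht
        have hcl : IsClosed {q : K | ((n : ℝ≥0∞))⁻¹ ≤ Metric.infEDist (ω q.1) Uᶜ} :=
          isClosed_le continuous_const
            (Metric.continuous_infEDist.comp (ω.continuous.comp continuous_subtype_val))
        have hle := closure_minimal (fun q hq => hn q hq) hcl (hDd (⟨t, ht⟩ : K))
        by_contra hne
        have h0 : Metric.infEDist (ω t) Uᶜ = 0 :=
          Metric.infEDist_zero_of_mem hne
        have hle' : ((n : ℝ≥0∞))⁻¹ ≤ Metric.infEDist (ω t) Uᶜ := hle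
        rw [h0] at hle'
        simp at hle'
    change MeasurableSet {ω : Trajectory E | MapsTo ω K U}
    rw [key]
    refine MeasurableSet.iUnion fun n => MeasurableSet.biInter hDc fun q _ => ?_
    exact measurable_coord q.1 (isClosed_le continuous_const
      Metric.continuous_infEDist).measurableSet

/-! ### Feller-Dynkin semigroups and diffusions -/

/-- A Feller-Dynkin semigroup on `C₀(E)`: a strongly continuous semigroup of bounded operators
with `0 ≤ f ≤ 1 → 0 ≤ P̂ₜ f ≤ 1`. -/
structure FellerDynkinSemigroup (E : Type*) [TopologicalSpace E] where
  op : ℝ≥0 → C₀(E, ℝ) →L[ℝ] C₀(E, ℝ)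
  op_comp : ∀ s t : ℝ≥0, (op s).comp (op t) = op (s + t)
  op_zero : op 0 = ContinuousLinearMap.id ℝ C₀(E, ℝ)
  strongly_continuous : ∀ f : C₀(E, ℝ), Tendsto (fun t : ℝ≥0 => op t f) (𝓝[>] 0) (𝓝 f)
  sub_markov : ∀ (t : ℝ≥0) (f : C₀(E, ℝ)), (∀ x, 0 ≤ f x ∧ f x ≤ 1) →
    ∀ x, 0 ≤ op t f x ∧ op t f x ≤ 1

/-- For times `s < t₁ < ⋯ < tₙ` and sets `C₁, …, Cₙ`, the iterated integral
`∫_{C₁} P_{t₁-s}(x, dx₁) ∫_{C₂} P_{t₂-t₁}(x₁, dx₂) ⋯ ∫_{Cₙ} P_{tₙ-tₙ₋₁}(xₙ₋₁, dxₙ)`. -/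
noncomputable def cylinderMass {E : Type*} [MeasurableSpace E] (P : ℝ≥0 → Kernel E E) :
    ℝ≥0 → List (ℝ≥0 × Set E) → E → ℝ≥0∞
  | _, [], _ => 1
  | s, (t, C) :: l, x => ∫⁻ y in C, cylinderMass P t l y ∂(P (t - s) x)

/-- A diffusion on `E`: an honest Feller-Dynkin process with continuous trajectories whose laws
`ℙˣ` depend weakly continuously on the starting point `x`. -/
structure Diffusion (E : Type*) [TopologicalSpace E] [LocallyCompactSpace E] [T2Space E]
    [SecondCountableTopology E] [MeasurableSpace E] [BorelSpace E] where
  /-- the Feller-Dynkin semigroup `(P̂ₜ)` -/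
  semigroup : FellerDynkinSemigroup E
  /-- the transition kernels `(Pₜ)`, determined by the semigroup through `kernel_repr` -/
  kernel : ℝ≥0 → Kernel E E
  kernel_repr : ∀ (t : ℝ≥0) (f : C₀(E, ℝ)) (x : E),
    semigroup.op t f x = ∫ y, f y ∂(kernel t x)
  /-- the semigroup is honest: `Pₜ(x, E) = 1` -/
  honest : ∀ t : ℝ≥0, IsMarkovKernel (kernel t)
  /-- the laws `ℙˣ` on trajectory space, determined by `law_cylinder` -/
  law : E → ProbabilityMeasure (Trajectory E)
  /-- finite-dimensional distributions: for `0 < t₁ < ⋯ < tₙ`,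
  `ℙˣ(X₀ ∈ dx₀, X_{t₁} ∈ dx₁, …, X_{tₙ} ∈ dxₙ) = δₓ(dx₀) P_{t₁}(x₀, dx₁) ⋯
  P_{tₙ-tₙ₋₁}(xₙ₋₁, dxₙ)` -/
  law_cylinder : ∀ (x : E) (C₀ : Set E) (l : List (ℝ≥0 × Set E)), MeasurableSet C₀ →
    (∀ p ∈ l, MeasurableSet p.2) → ((0 :: l.map Prod.fst).Pairwise (· < ·)) →
    (law x : Measure (Trajectory E)) {ω | ω 0 ∈ C₀ ∧ ∀ p ∈ l, ω p.1 ∈ p.2} =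
      ∫⁻ y in C₀, cylinderMass kernel 0 l y ∂(Measure.dirac x)
  /-- weak continuity of `x ↦ ℙˣ` -/
  law_continuous : Continuous law

/-! ### Optimal transport and the functional `𝒢_c` -/

/-- The set `Γ(μ, ν)` of couplings of `μ` and `ν`. -/
def couplings {X : Type*} [MeasurableSpace X] (μ ν : Measure X) : Set (Measure (X × X)) :=
  {γ | IsProbabilityMeasure γ ∧ γ.map Prod.fst = μ ∧ γ.map Prod.snd = ν}

/-- The optimal transport cost `W(k)(μ, ν) = inf {∫ k dγ | γ ∈ Γ(μ, ν)}` for a cost `k`. -/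
noncomputable def transportCost {X : Type*} [MeasurableSpace X] (k : X → X → ℝ)
    (μ ν : Measure X) : ℝ :=
  sInf ((fun γ : Measure (X × X) => ∫ p, k p.1 p.2 ∂γ) '' couplings μ ν)

/-- Membership in the lattice `𝒫`: lower semicontinuous pseudometrics bounded by `1`. -/
structure IsLscPseudometric {E : Type*} [TopologicalSpace E] (m : E → E → ℝ) : Prop where
  nonneg : ∀ x y, 0 ≤ m x y
  le_one : ∀ x y, m x y ≤ 1
  self : ∀ x, m x x = 0
  symm : ∀ x y, m x y = m y x
  triangle : ∀ x y z, m x z ≤ m x y + m y z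
  lsc : LowerSemicontinuous (fun p : E × E => m p.1 p.2)

/-- The discounted uniform pseudometric `U_c(m)(ω, ω') = sup_{t ≥ 0} cᵗ m(ω(t), ω'(t))`. -/
noncomputable def discountedUniform {E : Type*} [TopologicalSpace E] (c : ℝ) (m : E → E → ℝ)
    (ω ω' : Trajectory E) : ℝ :=
  ⨆ t : ℝ≥0, c ^ (t : ℝ) * m (ω t) (ω' t)

section

variable {E : Type*} [TopologicalSpace E] [LocallyCompactSpace E] [T2Space E]
  [SecondCountableTopology E] [MeasurableSpace E] [BorelSpace E]

/-- The functional `𝒢_c(m)(x, y) = W(U_c(m))(ℙˣ, ℙʸ)`. -/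
noncomputable def Diffusion.functional (X : Diffusion E) (c : ℝ) (m : E → E → ℝ) (x y : E) : ℝ :=
  transportCost (discountedUniform c m) (X.law x : Measure (Trajectory E)) (X.law y)

end

/-! ### The logic -/

mutual

/-- Expressions of the state logic `𝓛_σ`:  `f := q | obs | 1 - f | ∫ g`. -/
inductive StateExpr : Type
  | const (q : Set.Icc (0 : ℚ) 1) : StateExpr
  | obs : StateExpr
  | oneSub (f : StateExpr) : StateExpr
  | integral (g : TrajExpr) : StateExpr

/-- Expressions of the trajectory logic `𝓛_τ`:
`g := f ∘ ev_t | min {g₁, g₂} | max {g₁, g₂} | g ⊖ q | g ⊕ q`. -/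
inductive TrajExpr : Type
  | ev (f : StateExpr) (t : ℚ≥0) : TrajExpr
  | min (g₁ g₂ : TrajExpr) : TrajExpr
  | max (g₁ g₂ : TrajExpr) : TrajExpr
  | ominus (g : TrajExpr) (q : Set.Icc (0 : ℚ) 1) : TrajExpr
  | oplus (g : TrajExpr) (q : Set.Icc (0 : ℚ) 1) : TrajExpr

end

section

variable {E : Type*} [TopologicalSpace E] [LocallyCompactSpace E] [T2Space E]
  [SecondCountableTopology E] [MeasurableSpace E] [BorelSpace E]

mutual

/-- Interpretation of `f ∈ 𝓛_σ` as a function `E → [0,1]`, for the discount factor `c`. -/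
noncomputable def StateExpr.eval (X : Diffusion E) (obs : C(E, I)) (c : ℝ) :
    StateExpr → E → ℝ
  | .const q, _ => ((q : ℚ) : ℝ)
  | .obs, x => (obs x : ℝ)
  | .oneSub f, x => 1 - f.eval X obs c x
  | .integral g, x => ∫ ω, g.eval X obs c ω ∂(X.law x : Measure (Trajectory E))

/-- Interpretation of `g ∈ 𝓛_τ` as a function `Ω → [0,1]`, for the discount factor `c`. -/
noncomputable def TrajExpr.eval (X : Diffusion E) (obs : C(E, I)) (c : ℝ) :
    TrajExpr → Trajectory E → ℝ
  | .ev f t, ω => c ^ (t : ℝ) * f.eval X obs c (ω (t : ℝ≥0))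
  | .min g₁ g₂, ω => Min.min (g₁.eval X obs c ω) (g₂.eval X obs c ω)
  | .max g₁ g₂, ω => Max.max (g₁.eval X obs c ω) (g₂.eval X obs c ω)
  | .ominus g q, ω => Max.max 0 (g.eval X obs c ω - ((q : ℚ) : ℝ))
  | .oplus g q, ω => Min.min 1 (g.eval X obs c ω + ((q : ℚ) : ℝ))

end

/-- The pseudometric `ℓᶜ(x, y) = sup_{f ∈ 𝓛_σ} |f(x) - f(y)|`. -/
noncomputable def logicPseudometric (X : Diffusion E) (obs : C(E, I)) (c : ℝ) (x y : E) : ℝ :=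
  ⨆ f : StateExpr, |f.eval X obs c x - f.eval X obs c y|

end

end DiffusionLogic

namespace DiffusionLogic

/-! ### Trajectory spaces are Polish, and sets of couplings are compact -/

theorem polishSpace_of_locallyCompact (E : Type*) [TopologicalSpace E] [LocallyCompactSpace E]
    [T2Space E] [SecondCountableTopology E] : PolishSpace E := by
  let : MetricSpace E := TopologicalSpace.metrizableSpaceMetric E
  have hopen : IsOpen (range ((↑) : E → UniformSpace.Completion E)) := by
    rw [isOpen_iff_mem_nhds]
    rintro _ ⟨x, rfl⟩
    obtain ⟨K, hK, hxK⟩ := exists_compact_mem_nhds x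
    have h := (UniformSpace.Completion.isDenseInducing_coe (α := E)).closure_image_mem_nhds hxK
    rw [(hK.image (UniformSpace.Completion.continuous_coe E)).isClosed.closure_eq] at h
    exact mem_of_superset h (image_subset_range _ _)
  have : SecondCountableTopology (UniformSpace.Completion E) :=
    UniformSpace.secondCountable_of_separable _
  have := hopen.polishSpace
  exact (UniformSpace.Completion.isUniformEmbedding_coe E).isEmbedding.toHomeomorph
    |>.isClosedEmbedding.polishSpace

theorem polishSpace_trajectory (E : Type*) [TopologicalSpace E] [LocallyCompactSpace E]
    [T2Space E] [SecondCountableTopology E] : PolishSpace (Trajectory E) := by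
  have := polishSpace_of_locallyCompact E
  let := TopologicalSpace.upgradeIsCompletelyMetrizable E
  have : TopologicalSpace.IsCompletelyPseudoMetrizableSpace (Trajectory E) := inferInstance
  have : TopologicalSpace.IsCompletelyMetrizableSpace (Trajectory E) :=
    TopologicalSpace.IsCompletelyMetrizableSpace_of_isCompletelyPseudoMetrizableSpace
  exact {}

theorem isCompact_couplings {Ω : Type*} [TopologicalSpace Ω] [PolishSpace Ω] [MeasurableSpace Ω]
    [BorelSpace Ω] (μ ν : ProbabilityMeasure Ω) :
    IsCompact {γ : ProbabilityMeasure (Ω × Ω) | (γ : Measure (Ω × Ω)) ∈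
      couplings (μ : Measure Ω) (ν : Measure Ω)} := by
  set C := {γ : ProbabilityMeasure (Ω × Ω) | (γ : Measure (Ω × Ω)) ∈
      couplings (μ : Measure Ω) (ν : Measure Ω)} with hC
  have hclosed : IsClosed C := by
    have : C = {γ | γ.map (continuous_fst.measurable.aemeasurable) = μ} ∩
        {γ | γ.map (continuous_snd.measurable.aemeasurable) = ν} := by
      ext γ
      simp only [hC, couplings, mem_ofPred_eq, mem_inter_iff,
        ← ProbabilityMeasure.toMeasure_injective.eq_iff,
        ProbabilityMeasure.toMeasure_map]
      exact ⟨fun h => h.2, fun h => ⟨inferInstance, h⟩⟩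
    rw [this]
    exact (isClosed_eq (ProbabilityMeasure.continuous_map continuous_fst) continuous_const).inter
      (isClosed_eq (ProbabilityMeasure.continuous_map continuous_snd) continuous_const)
  rw [← hclosed.closure_eq]
  refine isCompact_closure_of_isTightMeasureSet (IsTightMeasureSet.prodMk ?_ ?_)
  · refine (isTightMeasureSet_singleton (μ := (μ : Measure Ω))).subset ?_
    rintro _ ⟨_, ⟨γ, hγ, rfl⟩, rfl⟩
    exact hγ.2.1
  · refine (isTightMeasureSet_singleton (μ := (ν : Measure Ω))).subset ?_
    rintro _ ⟨_, ⟨γ, hγ, rfl⟩, rfl⟩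
    exact hγ.2.2

/-! ### Kantorovich duality on finite spaces -/

theorem finite_kantorovich {S : Type*} [Fintype S] [Nonempty S] (d : S → S → ℝ)
    (dself : ∀ s, d s s = 0) (dtri : ∀ s t u, d s u ≤ d s t + d t u) (dle : ∀ s t, d s t ≤ 1)
    (p q : S → ℝ) (hp : ∀ s, 0 ≤ p s) (hq : ∀ s, 0 ≤ q s) (hp1 : ∑ s, p s = 1)
    (hq1 : ∑ s, q s = 1) (M : ℝ)
    (hM : ∀ h : S → ℝ, (∀ s, 0 ≤ h s ∧ h s ≤ 1) → (∀ s t, h s - h t ≤ d s t) →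
      ∑ s, h s * p s - ∑ s, h s * q s ≤ M) :
    ∃ π : S → S → ℝ, (∀ s t, 0 ≤ π s t) ∧ (∀ s, ∑ t, π s t = p s) ∧ (∀ t, ∑ s, π s t = q t) ∧
      ∑ s, ∑ t, π s t * d s t ≤ M := by
  classical
  have hM' : ∀ h : S → ℝ, (∀ s t, h s - h t ≤ d s t) →
      ∑ s, h s * p s - ∑ s, h s * q s ≤ M := by
    intro h hh
    obtain ⟨s₀, hs₀⟩ := Finite.exists_min h
    have := hM (fun s => h s - h s₀)
      (fun s => ⟨sub_nonneg.2 (hs₀ s), (hh s s₀).trans (dle s s₀)⟩)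
      (fun s t => by have := hh s t; linarith)
    simp only [sub_mul, Finset.sum_sub_distrib, ← Finset.mul_sum, hp1, hq1] at this
    linarith
  let T : (S × S → ℝ) →ₗ[ℝ] (S → ℝ) × (S → ℝ) × ℝ :=
    { toFun := fun w => (fun s => ∑ t, w (s, t), fun t => ∑ s, w (s, t), ∑ x, w x * d x.1 x.2)
      map_add' := fun a b => by
        ext <;> simp [Finset.sum_add_distrib, add_mul]
      map_smul' := fun r a => by
        ext <;> simp [Finset.mul_sum, mul_assoc] }
  have hT : Continuous T := T.continuous_of_finiteDimensional
  let C := T '' stdSimplex ℝ (S × S)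
  let D : Set ((S → ℝ) × (S → ℝ) × ℝ) := {p} ×ˢ ({q} ×ˢ Iic M)
  by_cases hdisj : Disjoint C D
  · exfalso
    obtain ⟨f, u, v, hfC, huv, hfD⟩ := geometric_hahn_banach_compact_closed
      ((convex_stdSimplex ℝ (S × S)).linear_image T) ((isCompact_stdSimplex ℝ (S × S)).image hT)
      ((convex_singleton p).prod ((convex_singleton q).prod (convex_Iic M)))
      (isClosed_singleton.prod (isClosed_singleton.prod isClosed_Iic)) hdisj
    set a : S → ℝ := fun s => f (Pi.single s 1, 0, 0) with ha
    set b : S → ℝ := fun s => f (0, Pi.single s 1, 0) with hb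
    set w : ℝ := f (0, 0, 1) with hw
    have hf : ∀ x : (S → ℝ) × (S → ℝ) × ℝ,
        f x = ∑ s, x.1 s * a s + ∑ s, x.2.1 s * b s + x.2.2 * w := by
      rintro ⟨x, y, z⟩
      have h1 : f (x, 0, 0) = ∑ s, x s * a s := by
        have := LinearMap.pi_apply_eq_sum_univ
          (f.toLinearMap ∘ₗ LinearMap.inl ℝ (S → ℝ) ((S → ℝ) × ℝ)) x
        simp only [LinearMap.comp_apply, LinearMap.inl_apply, smul_eq_mul] at this
        refine this.trans (Finset.sum_congr rfl fun s _ => ?_)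
        have e : (fun j => if s = j then (1 : ℝ) else 0) = Pi.single s 1 := by
          ext j; simp [Pi.single_apply, eq_comm]
        rw [e]; rfl
      have h2 : f (0, y, 0) = ∑ s, y s * b s := by
        have := LinearMap.pi_apply_eq_sum_univ
          (f.toLinearMap ∘ₗ LinearMap.inr ℝ (S → ℝ) ((S → ℝ) × ℝ) ∘ₗ LinearMap.inl ℝ (S → ℝ) ℝ) y
        simp only [LinearMap.comp_apply, LinearMap.inl_apply, LinearMap.inr_apply,
          smul_eq_mul] at this
        refine this.trans (Finset.sum_congr rfl fun s _ => ?_)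
        have e : (fun j => if s = j then (1 : ℝ) else 0) = Pi.single s 1 := by
          ext j; simp [Pi.single_apply, eq_comm]
        rw [e]; rfl
      have h3 : f (0, 0, z) = z * w := by
        have := f.map_smul z (0, 0, 1)
        simpa [hw] using this
      have : ((x, y, z) : (S → ℝ) × (S → ℝ) × ℝ) = (x, 0, 0) + (0, y, 0) + (0, 0, z) := by simp
      rw [this, map_add, map_add, h1, h2, h3]
      simp
    have hCst : ∀ s t, a s + b t + d s t * w < u := by
      intro s t
      have := hfC (T (Pi.single (s, t) 1)) ⟨_, single_mem_stdSimplex ℝ (s, t), rfl⟩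
      rw [hf] at this
      simpa [T, Pi.single_apply, Prod.ext_iff, ite_and, Finset.sum_ite_eq, Fintype.sum_prod_type]
        using this
    have hDz : ∀ z ≤ M, v < ∑ s, p s * a s + ∑ s, q s * b s + z * w := by
      intro z hz
      have := hfD (p, q, z) ⟨rfl, rfl, hz⟩
      rwa [hf] at this
    have hw0 : w ≤ 0 := by
      by_contra! hpos
      set c := ∑ s, p s * a s + ∑ s, q s * b s
      have h := hDz (min M ((v - c) / w)) (min_le_left _ _)
      have : min M ((v - c) / w) * w ≤ (v - c) / w * w :=
        mul_le_mul_of_nonneg_right (min_le_right _ _) hpos.le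
      rw [div_mul_cancel₀ _ hpos.ne'] at this
      linarith
    have hDM := hDz M le_rfl
    rcases hw0.eq_or_lt with hw0 | hwneg
    · have h1 : ∀ s, a s + ∑ t, q t * b t ≤ u := by
        intro s
        calc a s + ∑ t, q t * b t = ∑ t, q t * (a s + b t) := by
              simp [mul_add, Finset.sum_add_distrib, ← Finset.sum_mul, hq1]
          _ ≤ ∑ t, q t * u := Finset.sum_le_sum fun t _ =>
              mul_le_mul_of_nonneg_left (by have := hCst s t; rw [hw0] at this; linarith) (hq t)
          _ = u := by rw [← Finset.sum_mul, hq1, one_mul]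
      have h2 : ∑ s, p s * a s + ∑ t, q t * b t ≤ u := by
        calc ∑ s, p s * a s + ∑ t, q t * b t = ∑ s, p s * (a s + ∑ t, q t * b t) := by
              simp [mul_add, Finset.sum_add_distrib, ← Finset.sum_mul, hp1]
          _ ≤ ∑ s, p s * u := Finset.sum_le_sum fun s _ =>
              mul_le_mul_of_nonneg_left (h1 s) (hp s)
          _ = u := by rw [← Finset.sum_mul, hp1, one_mul]
      rw [hw0] at hDM
      linarith
    · set e := -w with he
      have he0 : 0 < e := by linarith
      set h : S → ℝ := fun s => Finset.univ.inf' Finset.univ_nonempty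
        (fun t => d s t - b t / e) with hh
      have hlip : ∀ s t, h s - h t ≤ d s t := by
        intro s t
        obtain ⟨r, -, hr⟩ := Finset.exists_mem_eq_inf' Finset.univ_nonempty
          (fun r => d t r - b r / e)
        have h1 : h s ≤ d s r - b r / e := Finset.inf'_le _ (Finset.mem_univ r)
        have h2 : h t = d t r - b r / e := hr
        have := dtri s t r
        linarith
      have hub : ∀ s, h s ≤ - b s / e := by
        intro s
        have : h s ≤ d s s - b s / e := Finset.inf'_le _ (Finset.mem_univ s)
        rw [dself] at this
        rw [neg_div]; linarith
      have hlb : ∀ s, (a s - u) / e ≤ h s := by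
        intro s
        refine Finset.le_inf' _ _ fun t _ => ?_
        have := hCst s t
        rw [div_le_iff₀ he0, sub_mul, div_mul_cancel₀ _ he0.ne']
        simp only [he]; linarith
      have h1 : (∑ s, p s * a s - u) / e ≤ ∑ s, h s * p s := by
        calc (∑ s, p s * a s - u) / e = ∑ s, (p s * a s - p s * u) / e := by
              rw [← Finset.sum_div, Finset.sum_sub_distrib, ← Finset.sum_mul, hp1, one_mul]
          _ = ∑ s, (a s - u) / e * p s := Finset.sum_congr rfl fun s _ => by ring
          _ ≤ _ := Finset.sum_le_sum fun s _ => mul_le_mul_of_nonneg_right (hlb s) (hp s)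
      have h2 : ∑ s, h s * q s ≤ - (∑ s, q s * b s) / e := by
        calc ∑ s, h s * q s ≤ ∑ s, - b s / e * q s :=
              Finset.sum_le_sum fun s _ => mul_le_mul_of_nonneg_right (hub s) (hq s)
          _ = ∑ s, -(q s * b s / e) := Finset.sum_congr rfl fun s _ => by ring
          _ = _ := by rw [Finset.sum_neg_distrib, ← Finset.sum_div, neg_div]
      have h3 := hM' h hlip
      have h4 : (∑ s, p s * a s + ∑ s, q s * b s - u) / e ≤ M := by
        calc _ = (∑ s, p s * a s - u) / e - (- (∑ s, q s * b s) / e) := by ring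
          _ ≤ _ := by linarith
      rw [div_le_iff₀ he0] at h4
      simp only [he] at h4
      linarith
  · obtain ⟨_, ⟨π, hπ, rfl⟩, hD⟩ := Set.not_disjoint_iff.1 hdisj
    obtain ⟨h1, h2, h3⟩ := hD
    refine ⟨fun s t => π (s, t), fun s t => hπ.1 _, fun s => congrFun h1 s,
      fun t => congrFun h2 t, ?_⟩
    rw [← Fintype.sum_prod_type' (f := fun s t => π (s, t) * d s t)]
    exact h3

/-! ### Lattice approximation -/

/-- Closure of a set of functions under the trajectory connectives `min`, `max`, `⊖ q`, `⊕ q`. -/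
structure IsClosedUnderConnectives {Ω : Type*} (A : Set (Ω → ℝ)) : Prop where
  inf : ∀ f ∈ A, ∀ g ∈ A, f ⊓ g ∈ A
  sup : ∀ f ∈ A, ∀ g ∈ A, f ⊔ g ∈ A
  ominus : ∀ f ∈ A, ∀ q : Set.Icc (0 : ℚ) 1, (fun ω => max 0 (f ω - ((q : ℚ) : ℝ))) ∈ A
  oplus : ∀ f ∈ A, ∀ q : Set.Icc (0 : ℚ) 1, (fun ω => min 1 (f ω + ((q : ℚ) : ℝ))) ∈ A

theorem exists_rat_Icc_near {x ε : ℝ} (hx0 : 0 ≤ x) (hx1 : x ≤ 1) (hε : 0 < ε) :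
    ∃ q : Set.Icc (0 : ℚ) 1, |((q : ℚ) : ℝ) - x| ≤ ε := by
  rcases le_total x (1 / 2) with h | h
  · obtain ⟨q, hq1, hq2⟩ := exists_rat_btwn (show x < min (x + ε) 1 from
      lt_min (by linarith) (by linarith))
    have := lt_min_iff.1 hq2
    refine ⟨⟨q, ?_, ?_⟩, abs_le.2 ⟨by simp only; linarith, by simp only; linarith⟩⟩
    · exact_mod_cast hx0.trans hq1.le
    · exact_mod_cast this.2.le
  · obtain ⟨q, hq1, hq2⟩ := exists_rat_btwn (show max (x - ε) 0 < x from
      max_lt (by linarith) (by linarith))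
    have := max_lt_iff.1 hq1
    refine ⟨⟨q, ?_, ?_⟩, abs_le.2 ⟨by simp only; linarith, by simp only; linarith⟩⟩
    · exact_mod_cast this.2.le
    · exact_mod_cast hq2.le.trans hx1

namespace IsClosedUnderConnectives

variable {Ω : Type*} {A : Set (Ω → ℝ)}

theorem exists_two_point_approx_of_le (hA : IsClosedUnderConnectives A) {ω ω' : Ω} {g : Ω → ℝ}
    (hg : g ∈ A) (hg0 : 0 ≤ g ω') (hg1 : g ω ≤ 1) {a b : ℝ} (hb : 0 ≤ b) (ha : a ≤ 1)
    (hba : b ≤ a) (hab : a - b ≤ g ω - g ω') {ε : ℝ} (hε : 0 < ε) :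
    ∃ f ∈ A, |f ω - a| ≤ ε ∧ |f ω' - b| ≤ ε := by
  obtain ⟨q, hq⟩ := exists_rat_Icc_near (x := g ω - (a - b)) (by linarith) (by linarith)
    (half_pos hε)
  obtain ⟨r, hr⟩ := exists_rat_Icc_near (x := b) hb (by linarith) (half_pos hε)
  refine ⟨_, hA.oplus _ (hA.ominus g hg q) r, ?_, ?_⟩
  all_goals
    rw [abs_le] at *
    grind

theorem exists_two_point_approx (hA : IsClosedUnderConnectives A)
    (hA01 : ∀ g ∈ A, ∀ ω, 0 ≤ g ω ∧ g ω ≤ 1) {k : Ω → Ω → ℝ}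
    (hk : ∀ ω ω', ∃ g ∈ A, k ω ω' ≤ g ω - g ω') {ω ω' : Ω} {a b : ℝ}
    (ha : 0 ≤ a ∧ a ≤ 1) (hb : 0 ≤ b ∧ b ≤ 1) (hab : a - b ≤ k ω ω') (hba : b - a ≤ k ω' ω)
    {ε : ℝ} (hε : 0 < ε) :
    ∃ f ∈ A, |f ω - a| ≤ ε ∧ |f ω' - b| ≤ ε := by
  rcases le_total b a with h | h
  · obtain ⟨g, hg, hkg⟩ := hk ω ω'
    exact hA.exists_two_point_approx_of_le hg (hA01 g hg _).1 (hA01 g hg _).2 hb.1 ha.2 h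
      (hab.trans hkg) hε
  · obtain ⟨g, hg, hkg⟩ := hk ω' ω
    obtain ⟨f, hf, h1, h2⟩ := hA.exists_two_point_approx_of_le hg (hA01 g hg _).1
      (hA01 g hg _).2 ha.1 hb.2 h (hba.trans hkg) hε
    exact ⟨f, hf, h2, h1⟩

theorem exists_approx (hA : IsClosedUnderConnectives A)
    (hA01 : ∀ g ∈ A, ∀ ω, 0 ≤ g ω ∧ g ω ≤ 1) {k : Ω → Ω → ℝ}
    (hk : ∀ ω ω', ∃ g ∈ A, k ω ω' ≤ g ω - g ω') {S : Type*} [Fintype S] [Nonempty S]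
    (pt : S → Ω) (h : S → ℝ) (h01 : ∀ s, 0 ≤ h s ∧ h s ≤ 1)
    (hlip : ∀ s t, h s - h t ≤ k (pt s) (pt t)) {ε : ℝ} (hε : 0 < ε) :
    ∃ f ∈ A, ∀ s, |f (pt s) - h s| ≤ ε := by
  choose f hfA hf1 hf2 using fun s t =>
    hA.exists_two_point_approx hA01 hk (h01 s) (h01 t) (hlip s t) (hlip t s) hε
  refine ⟨Finset.univ.sup' Finset.univ_nonempty
    fun s => Finset.univ.inf' Finset.univ_nonempty fun t => f s t, ?_, fun r => ?_⟩
  · exact Finset.sup'_induction _ _ hA.sup fun s _ =>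
      Finset.inf'_induction _ _ hA.inf fun t _ => hfA s t
  · rw [Finset.sup'_apply, abs_le]
    constructor
    · have : h r - ε ≤ Finset.univ.inf' Finset.univ_nonempty (fun t => f r t) (pt r) := by
        rw [Finset.inf'_apply]
        refine Finset.le_inf' _ _ fun t _ => ?_
        have := (abs_le.1 (hf1 r t)).1
        linarith
      have h2 := Finset.le_sup' (fun s => (Finset.univ.inf' Finset.univ_nonempty
        fun t => f s t) (pt r)) (Finset.mem_univ r)
      linarith
    · rw [sub_le_iff_le_add]
      refine Finset.sup'_le _ _ fun s _ => ?_
      rw [Finset.inf'_apply]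
      refine (Finset.inf'_le _ (Finset.mem_univ r)).trans ?_
      have := (abs_le.1 (hf2 s r)).2
      linarith

end IsClosedUnderConnectives

/-! ### Couplings from finite partitions -/

theorem exists_finite_partition {Ω : Type*} [MeasurableSpace Ω] {ι : Type} [Fintype ι]
    {G : Ω → ι → ℝ} (hG : Measurable G) (hG01 : ∀ ω i, 0 ≤ G ω i ∧ G ω i ≤ 1) {ε : ℝ}
    (hε : 0 < ε) :
    ∃ (S : Type) (_ : Fintype S) (φ : Ω → S) (pt : S → Ω),
      (∀ s, MeasurableSet (φ ⁻¹' {s})) ∧ (∀ s, φ (pt s) = s) ∧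
      ∀ ω, dist (G ω) (G (pt (φ ω))) ≤ ε := by
  classical
  obtain ⟨K, hK⟩ := exists_nat_gt (1 / ε)
  have hK0 : (0 : ℝ) < K := (one_div_pos.2 hε).trans hK
  let Φ : Ω → ι → Fin (K + 1) := fun ω i =>
    ⟨⌊K * G ω i⌋₊, Nat.lt_succ_of_le (Nat.floor_le_of_le (by nlinarith [hG01 ω i]))⟩
  have hΦ : ∀ x, MeasurableSet (Φ ⁻¹' {x}) := by
    intro x
    have : Φ ⁻¹' {x} = ⋂ i, (fun ω => ⌊K * G ω i⌋₊) ⁻¹' {(x i : ℕ)} := by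
      ext ω
      simp [Φ, funext_iff, Fin.ext_iff]
    rw [this]
    refine MeasurableSet.iInter fun i => ?_
    exact (Nat.measurable_floor.comp
      (measurable_const.mul ((measurable_pi_apply i).comp hG))) (measurableSet_singleton _)
  choose pt hpt using fun s : range Φ => s.2
  refine ⟨range Φ, inferInstance, rangeFactorization Φ, pt, fun s => ?_,
    fun s => Subtype.ext (hpt s), fun ω => ?_⟩
  · convert hΦ s.1 using 1
    ext ω
    simp [Subtype.ext_iff, rangeFactorization]
  · rw [dist_pi_le_iff hε.le]
    intro i
    have h1 : Φ (pt (rangeFactorization Φ ω)) = Φ ω := hpt _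
    have h2 := congrArg Fin.val (congrFun h1 i)
    simp only [Φ] at h2
    set ω' := pt (rangeFactorization Φ ω)
    have h3 := Nat.floor_le (mul_nonneg hK0.le (hG01 ω i).1)
    have h4 := Nat.lt_floor_add_one (K * G ω i)
    have h5 := Nat.floor_le (mul_nonneg hK0.le (hG01 ω' i).1)
    have h6 := Nat.lt_floor_add_one (K * G ω' i)
    rw [h2] at h5 h6
    rw [div_lt_iff₀ hε] at hK
    rw [Real.dist_eq, abs_le]
    constructor <;> by_contra! hc <;> nlinarith

theorem exists_coupling_of_marginals {Ω : Type*} [MeasurableSpace Ω] (μ ν : Measure Ω)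
    [IsProbabilityMeasure μ] [IsProbabilityMeasure ν] {S : Type*} [Fintype S] (φ : Ω → S)
    (hφ : ∀ s, MeasurableSet (φ ⁻¹' {s})) (π : S → S → ℝ) (hπ : ∀ s t, 0 ≤ π s t)
    (hπ1 : ∀ s, ∑ t, π s t = μ.real (φ ⁻¹' {s})) (hπ2 : ∀ t, ∑ s, π s t = ν.real (φ ⁻¹' {t})) :
    ∃ γ ∈ couplings μ ν, ∀ (k : Ω × Ω → ℝ) (D : S → S → ℝ), Measurable k →
      (∃ B, ∀ x, |k x| ≤ B) → (∀ x, k x ≤ D (φ x.1) (φ x.2)) →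
      ∫ x, k x ∂γ ≤ ∑ s, ∑ t, π s t * D s t := by
  classical
  let α : S → Measure Ω := fun s => ProbabilityTheory.cond μ (φ ⁻¹' {s})
  let β : S → Measure Ω := fun s => ProbabilityTheory.cond ν (φ ⁻¹' {s})
  have hdec : ∀ (ρ : Measure Ω) [IsProbabilityMeasure ρ],
      ∑ s, ρ (φ ⁻¹' {s}) • ProbabilityTheory.cond ρ (φ ⁻¹' {s}) = ρ := by
    intro ρ _
    ext B hB
    simp only [Measure.coe_finsetSum, Finset.sum_apply, Measure.smul_apply, smul_eq_mul]
    have : ∀ s, ρ (φ ⁻¹' {s}) * ProbabilityTheory.cond ρ (φ ⁻¹' {s}) B =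
        ρ (φ ⁻¹' {s} ∩ B) := fun s => by
      rw [mul_comm, ProbabilityTheory.cond_mul_eq_inter (hφ s)]
    simp only [this]
    rw [← measure_biUnion_finset]
    · congr 1; ext ω; simp
    · intro s _ t _ hst
      refine Disjoint.inter_left _ (Disjoint.inter_right _ ?_)
      exact Disjoint.preimage _ (by simpa using hst)
    · exact fun s _ => (hφ s).inter hB
  have hα : ∀ s t, π s t ≠ 0 → IsProbabilityMeasure (α s) := by
    intro s t h
    refine ProbabilityTheory.cond_isProbabilityMeasure fun h0 => h ?_
    have h1 := hπ1 s
    rw [Measure.real, h0, ENNReal.toReal_zero,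
      Finset.sum_eq_zero_iff_of_nonneg fun t _ => hπ s t] at h1
    exact h1 t (Finset.mem_univ t)
  have hβ : ∀ s t, π s t ≠ 0 → IsProbabilityMeasure (β t) := by
    intro s t h
    refine ProbabilityTheory.cond_isProbabilityMeasure fun h0 => h ?_
    have h1 := hπ2 t
    rw [Measure.real, h0, ENNReal.toReal_zero,
      Finset.sum_eq_zero_iff_of_nonneg fun s _ => hπ s t] at h1
    exact h1 s (Finset.mem_univ s)
  let γ : Measure (Ω × Ω) := ∑ s, ∑ t, ENNReal.ofReal (π s t) • (α s).prod (β t)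
  have hfst : γ.map Prod.fst = μ := by
    conv_rhs => rw [← hdec μ]
    simp only [γ, Measure.map_finset_sum measurable_fst.aemeasurable, Measure.map_smul]
    refine Finset.sum_congr rfl fun s _ => ?_
    have : ∀ t, ENNReal.ofReal (π s t) • ((α s).prod (β t)).map Prod.fst =
        ENNReal.ofReal (π s t) • α s := by
      intro t
      by_cases h : π s t = 0
      · simp [h]
      · have := hβ s t h
        rw [Measure.map_fst_prod]; simp
    simp only [this]
    rw [← Finset.sum_smul, ← ENNReal.ofReal_sum_of_nonneg fun t _ => hπ s t, hπ1,
      ofReal_measureReal]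
  have hsnd : γ.map Prod.snd = ν := by
    conv_rhs => rw [← hdec ν]
    simp only [γ]
    rw [Finset.sum_comm]
    simp only [Measure.map_finset_sum measurable_snd.aemeasurable, Measure.map_smul]
    refine Finset.sum_congr rfl fun t _ => ?_
    have : ∀ s, ENNReal.ofReal (π s t) • ((α s).prod (β t)).map Prod.snd =
        ENNReal.ofReal (π s t) • β t := by
      intro s
      by_cases h : π s t = 0
      · simp [h]
      · have := hα s t h
        rw [Measure.map_snd_prod]; simp
    simp only [this]
    rw [← Finset.sum_smul, ← ENNReal.ofReal_sum_of_nonneg fun s _ => hπ s t, hπ2,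
      ofReal_measureReal]
  have hγ : IsProbabilityMeasure γ := by
    constructor
    have : γ.map Prod.fst univ = 1 := by rw [hfst]; exact measure_univ
    rwa [Measure.map_apply measurable_fst MeasurableSet.univ] at this
  refine ⟨γ, ⟨hγ, hfst, hsnd⟩, fun k D hk ⟨B, hB⟩ hkD => ?_⟩
  have hInt : ∀ (ρ : Measure (Ω × Ω)) [IsFiniteMeasure ρ], Integrable k ρ := fun ρ _ =>
    Integrable.of_bound hk.aestronglyMeasurable B (ae_of_all _ hB)
  have hInt' : ∀ s t, Integrable k (ENNReal.ofReal (π s t) • (α s).prod (β t)) := fun s t =>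
    (hInt _).smul_measure ENNReal.ofReal_ne_top
  simp only [γ]
  rw [integral_finsetSum_measure fun s _ => integrable_finsetSum_measure.2 fun t _ => hInt' s t]
  refine Finset.sum_le_sum fun s _ => ?_
  rw [integral_finsetSum_measure fun t _ => hInt' s t]
  refine Finset.sum_le_sum fun t _ => ?_
  rw [integral_smul_measure, ENNReal.toReal_ofReal (hπ s t), smul_eq_mul]
  by_cases h : π s t = 0
  · simp [h]
  have := hα s t h
  have := hβ s t h
  refine mul_le_mul_of_nonneg_left ?_ (hπ s t)
  have h1 : ∀ᵐ x ∂(α s).prod (β t), φ x.1 = s :=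
    Measure.quasiMeasurePreserving_fst.ae (ProbabilityTheory.ae_cond_mem (hφ s))
  have h2 : ∀ᵐ x ∂(α s).prod (β t), φ x.2 = t :=
    Measure.quasiMeasurePreserving_snd.ae (ProbabilityTheory.ae_cond_mem (hφ t))
  calc ∫ x, k x ∂(α s).prod (β t) ≤ ∫ _, D s t ∂(α s).prod (β t) := by
        refine integral_mono_ae (hInt _) (integrable_const _) ?_
        filter_upwards [h1, h2] with x hx1 hx2
        simpa [hx1, hx2] using hkD x
    _ = D s t := by simp

theorem integral_comp_eq_sum {Ω : Type*} [MeasurableSpace Ω] (μ : Measure Ω)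
    [IsFiniteMeasure μ] {S : Type*} [Fintype S] (φ : Ω → S)
    (hφ : ∀ s, MeasurableSet (φ ⁻¹' {s})) (h : S → ℝ) :
    ∫ ω, h (φ ω) ∂μ = ∑ s, h s * μ.real (φ ⁻¹' {s}) := by
  let _ : MeasurableSpace S := ⊤
  have hm : Measurable φ := measurable_to_countable' hφ
  rw [← integral_map hm.aemeasurable (by fun_prop) (f := h), integral_fintype .of_finite]
  refine Finset.sum_congr rfl fun s _ => ?_
  rw [map_measureReal_apply hm (measurableSet_singleton s), smul_eq_mul, mul_comm]

/-- Kantorovich duality, up to `ε`, for the cost `dist (G ω) (G ω')` given by finitely many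
functions, with test functions taken from a set closed under the connectives. -/
theorem exists_coupling_integral_dist_le {Ω : Type*} [MeasurableSpace Ω] (μ ν : Measure Ω)
    [IsProbabilityMeasure μ] [IsProbabilityMeasure ν] {ι : Type} [Fintype ι] {G : Ω → ι → ℝ}
    (hG : Measurable G) (hG01 : ∀ ω i, 0 ≤ G ω i ∧ G ω i ≤ 1) {A : Set (Ω → ℝ)}
    (hA : IsClosedUnderConnectives A) (hAm : ∀ g ∈ A, Measurable g)
    (hA01 : ∀ g ∈ A, ∀ ω, 0 ≤ g ω ∧ g ω ≤ 1)
    (hAG : ∀ g ∈ A, ∀ ω ω', g ω - g ω' ≤ dist (G ω) (G ω'))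
    (hGA : ∀ ω ω', ∃ g ∈ A, dist (G ω) (G ω') ≤ g ω - g ω') {M : ℝ}
    (hM : ∀ g ∈ A, ∫ ω, g ω ∂μ - ∫ ω, g ω ∂ν ≤ M) {ε : ℝ} (hε : 0 < ε) :
    ∃ γ ∈ couplings μ ν, ∫ x, dist (G x.1) (G x.2) ∂γ ≤ M + ε := by
  set δ := ε / 6 with hδ
  have hδ0 : 0 < δ := by positivity
  obtain ⟨S, _, φ, pt, hφ, hpt, hφG⟩ := exists_finite_partition hG hG01 hδ0
  have : Nonempty S := (nonempty_of_isProbabilityMeasure μ).map φ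
  have hd1 : ∀ ω ω', dist (G ω) (G ω') ≤ 1 := fun ω ω' =>
    (dist_pi_le_iff zero_le_one).2 fun i => by
      rw [Real.dist_eq, abs_le]
      constructor <;> linarith [hG01 ω i, hG01 ω' i]
  have hsum : ∀ (ρ : Measure Ω) [IsProbabilityMeasure ρ], ∑ s, ρ.real (φ ⁻¹' {s}) = 1 := by
    intro ρ _
    have := integral_comp_eq_sum ρ φ hφ (fun _ => 1)
    simpa using this.symm
  obtain ⟨π, hπ, hπ1, hπ2, hπd⟩ := finite_kantorovich
    (fun s t => dist (G (pt s)) (G (pt t))) (fun s => dist_self _)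
    (fun s t u => dist_triangle _ _ _) (fun s t => hd1 _ _)
    (fun s => μ.real (φ ⁻¹' {s})) (fun s => ν.real (φ ⁻¹' {s}))
    (fun s => measureReal_nonneg) (fun s => measureReal_nonneg) (hsum μ) (hsum ν) (M + 4 * δ)
    (by
      intro h h01 hlip
      obtain ⟨g, hg, hgh⟩ := hA.exists_approx hA01 hGA pt h h01 hlip hδ0
      have hclose : ∀ ω, |g ω - h (φ ω)| ≤ 2 * δ := by
        intro ω
        have h1 := hAG g hg ω (pt (φ ω))
        have h2 := hAG g hg (pt (φ ω)) ω
        have h3 := hφG ω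
        have h4 := abs_le.1 (hgh (φ ω))
        rw [dist_comm] at h2
        rw [abs_le]
        constructor <;> linarith
      have hInt : ∀ (ρ : Measure Ω) [IsProbabilityMeasure ρ],
          |∫ ω, g ω ∂ρ - ∑ s, h s * ρ.real (φ ⁻¹' {s})| ≤ 2 * δ := by
        intro ρ _
        have hhm : Measurable fun ω => h (φ ω) := by
          let _ : MeasurableSpace S := ⊤
          exact (measurable_of_countable h).comp (measurable_to_countable' hφ)
        rw [← integral_comp_eq_sum ρ φ hφ h, ← integral_sub]
        · have := norm_integral_le_of_norm_le_const (μ := ρ)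
            (f := fun ω => g ω - h (φ ω)) (C := 2 * δ) (ae_of_all _ hclose)
          simpa using this
        · exact Integrable.of_bound (hAm g hg).aestronglyMeasurable 1
            (ae_of_all _ fun ω => abs_le.2 ⟨by linarith [hA01 g hg ω], (hA01 g hg ω).2⟩)
        · exact Integrable.of_bound hhm.aestronglyMeasurable 1
            (ae_of_all _ fun ω => abs_le.2 ⟨by linarith [h01 (φ ω)], (h01 (φ ω)).2⟩)
      have h1 := abs_le.1 (hInt μ)
      have h2 := abs_le.1 (hInt ν)
      have h3 := hM g hg
      linarith)
  obtain ⟨γ, hγ, hγk⟩ := exists_coupling_of_marginals μ ν φ hφ π hπ hπ1 hπ2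
  refine ⟨γ, hγ, (hγk (fun x => dist (G x.1) (G x.2))
    (fun s t => dist (G (pt s)) (G (pt t)) + 2 * δ)
    ((hG.comp measurable_fst).dist (hG.comp measurable_snd))
    ⟨1, fun x => by rw [abs_of_nonneg dist_nonneg]; exact hd1 _ _⟩ fun x => ?_).trans ?_⟩
  · have h1 := dist_triangle4 (G x.1) (G (pt (φ x.1))) (G (pt (φ x.2))) (G x.2)
    have h2 := hφG x.1
    have h3 := hφG x.2
    rw [dist_comm] at h3
    linarith
  · have : ∑ s, ∑ t, π s t = 1 := by simp only [hπ1, hsum μ]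
    simp only [mul_add, Finset.sum_add_distrib, ← Finset.sum_mul, this]
    linarith

/-! ### Countability of the logic -/

mutual

/-- A Gödel numbering of state expressions. -/
def StateExpr.code : StateExpr → ℕ
  | .const q => Nat.pair 0 (Encodable.encode q)
  | .obs => Nat.pair 1 0
  | .oneSub f => Nat.pair 2 f.code
  | .integral g => Nat.pair 3 g.code

/-- A Gödel numbering of trajectory expressions. -/
def TrajExpr.code : TrajExpr → ℕ
  | .ev f t => Nat.pair 0 (Nat.pair f.code (Encodable.encode t))
  | .min g₁ g₂ => Nat.pair 1 (Nat.pair g₁.code g₂.code)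
  | .max g₁ g₂ => Nat.pair 2 (Nat.pair g₁.code g₂.code)
  | .ominus g q => Nat.pair 3 (Nat.pair g.code (Encodable.encode q))
  | .oplus g q => Nat.pair 4 (Nat.pair g.code (Encodable.encode q))

end

mutual

theorem StateExpr.code_injective : ∀ f f' : StateExpr, f.code = f'.code → f = f'
  | .const q, f' => by cases f' <;> simp [StateExpr.code]
  | .obs, f' => by cases f' <;> simp [StateExpr.code]
  | .oneSub f, f' => by
      cases f' <;> simp [StateExpr.code]
      exact StateExpr.code_injective f _
  | .integral g, f' => by
      cases f' <;> simp [StateExpr.code]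
      exact TrajExpr.code_injective g _

theorem TrajExpr.code_injective : ∀ g g' : TrajExpr, g.code = g'.code → g = g'
  | .ev f t, g' => by
      cases g' <;> simp [TrajExpr.code]
      exact fun h ht => ⟨StateExpr.code_injective f _ h, ht⟩
  | .min g₁ g₂, g' => by
      cases g' <;> simp [TrajExpr.code]
      exact fun h₁ h₂ => ⟨TrajExpr.code_injective g₁ _ h₁, TrajExpr.code_injective g₂ _ h₂⟩
  | .max g₁ g₂, g' => by
      cases g' <;> simp [TrajExpr.code]
      exact fun h₁ h₂ => ⟨TrajExpr.code_injective g₁ _ h₁, TrajExpr.code_injective g₂ _ h₂⟩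
  | .ominus g q, g' => by
      cases g' <;> simp [TrajExpr.code]
      exact fun h hq => ⟨TrajExpr.code_injective g _ h, hq⟩
  | .oplus g q, g' => by
      cases g' <;> simp [TrajExpr.code]
      exact fun h hq => ⟨TrajExpr.code_injective g _ h, hq⟩

end

instance : Countable StateExpr :=
  Function.Injective.countable (f := StateExpr.code) fun f f' => StateExpr.code_injective f f'

instance : Nonempty StateExpr := ⟨.obs⟩

/-! ### Continuity of the interpretations -/

section

variable {E : Type*} [TopologicalSpace E] [LocallyCompactSpace E] [T2Space E]
  [SecondCountableTopology E] [MeasurableSpace E] [BorelSpace E]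

theorem pow_mem_unitInterval {c : ℝ} (hc₀ : 0 < c) (hc₁ : c < 1) (t : ℝ≥0) :
    0 ≤ c ^ (t : ℝ) ∧ c ^ (t : ℝ) ≤ 1 :=
  ⟨(Real.rpow_pos_of_pos hc₀ _).le, Real.rpow_le_one hc₀.le hc₁.le t.2⟩

theorem integral_mem_unitInterval {Ω : Type*} [MeasurableSpace Ω] (μ : Measure Ω)
    [IsProbabilityMeasure μ] {g : Ω → ℝ} (hg : ∀ ω, 0 ≤ g ω ∧ g ω ≤ 1) :
    0 ≤ ∫ ω, g ω ∂μ ∧ ∫ ω, g ω ∂μ ≤ 1 := by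
  refine ⟨integral_nonneg fun ω => (hg ω).1, ?_⟩
  have := norm_integral_le_of_norm_le_const (μ := μ) (f := g) (C := 1)
    (ae_of_all _ fun ω => by rw [Real.norm_eq_abs, abs_of_nonneg (hg ω).1]; exact (hg ω).2)
  simpa using (le_abs_self _).trans this

theorem continuous_integral_probabilityMeasure {Ω : Type*} [TopologicalSpace Ω]
    [MeasurableSpace Ω] [OpensMeasurableSpace Ω] {g : Ω → ℝ} (hg : Continuous g)
    (hg01 : ∀ ω, 0 ≤ g ω ∧ g ω ≤ 1) :
    Continuous fun μ : ProbabilityMeasure Ω => ∫ ω, g ω ∂(μ : Measure Ω) := by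
  let G : BoundedContinuousFunction Ω ℝ := BoundedContinuousFunction.ofNormedAddCommGroup g hg 1
    fun ω => by rw [Real.norm_eq_abs, abs_of_nonneg (hg01 ω).1]; exact (hg01 ω).2
  exact continuous_iff_continuousAt.2 fun μ =>
    ProbabilityMeasure.tendsto_iff_forall_integral_tendsto.1 (continuous_id.continuousAt) G

mutual

theorem StateExpr.continuous_eval_and_mem (X : Diffusion E) (obs : C(E, I)) {c : ℝ}
    (hc₀ : 0 < c) (hc₁ : c < 1) : ∀ f : StateExpr,
    Continuous (f.eval X obs c) ∧ ∀ x, 0 ≤ f.eval X obs c x ∧ f.eval X obs c x ≤ 1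
  | .const q => by
      have : StateExpr.eval X obs c (.const q) = fun _ => ((q : ℚ) : ℝ) :=
        funext fun x => by rw [StateExpr.eval]
      rw [this]
      have hq0 : (0 : ℝ) ≤ ((q : ℚ) : ℝ) := by exact_mod_cast q.2.1
      have hq1 : ((q : ℚ) : ℝ) ≤ 1 := by exact_mod_cast q.2.2
      exact ⟨continuous_const, fun x => ⟨hq0, hq1⟩⟩
  | .obs => by
      have : StateExpr.eval X obs c .obs = fun x => (obs x : ℝ) :=
        funext fun x => by rw [StateExpr.eval]
      rw [this]
      exact ⟨by fun_prop, fun x => (obs x).2⟩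
  | .oneSub f => by
      have : StateExpr.eval X obs c (.oneSub f) = fun x => 1 - f.eval X obs c x :=
        funext fun x => by rw [StateExpr.eval]
      rw [this]
      obtain ⟨h1, h2⟩ := StateExpr.continuous_eval_and_mem X obs hc₀ hc₁ f
      exact ⟨continuous_const.sub h1, fun x => ⟨by linarith [h2 x], by linarith [h2 x]⟩⟩
  | .integral g => by
      have : StateExpr.eval X obs c (.integral g) =
          fun x => ∫ ω, g.eval X obs c ω ∂(X.law x : Measure (Trajectory E)) :=
        funext fun x => by rw [StateExpr.eval]
      rw [this]
      obtain ⟨h1, h2⟩ := TrajExpr.continuous_eval_and_mem X obs hc₀ hc₁ g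
      exact ⟨(continuous_integral_probabilityMeasure h1 h2).comp X.law_continuous,
        fun x => integral_mem_unitInterval _ h2⟩

theorem TrajExpr.continuous_eval_and_mem (X : Diffusion E) (obs : C(E, I)) {c : ℝ}
    (hc₀ : 0 < c) (hc₁ : c < 1) : ∀ g : TrajExpr,
    Continuous (g.eval X obs c) ∧ ∀ ω, 0 ≤ g.eval X obs c ω ∧ g.eval X obs c ω ≤ 1
  | .ev f t => by
      have : TrajExpr.eval X obs c (.ev f t) =
          fun ω => c ^ (t : ℝ) * f.eval X obs c (ω (t : ℝ≥0)) :=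
        funext fun x => by rw [TrajExpr.eval]
      rw [this]
      obtain ⟨h1, h2⟩ := StateExpr.continuous_eval_and_mem X obs hc₀ hc₁ f
      have ht : 0 ≤ c ^ (t : ℝ) ∧ c ^ (t : ℝ) ≤ 1 := pow_mem_unitInterval hc₀ hc₁ (t : ℝ≥0)
      exact ⟨continuous_const.mul (h1.comp (continuous_eval_const _)), fun ω =>
        ⟨mul_nonneg ht.1 (h2 _).1, mul_le_one₀ ht.2 (h2 _).1 (h2 _).2⟩⟩
  | .min g₁ g₂ => by
      have : TrajExpr.eval X obs c (.min g₁ g₂) =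
          fun ω => min (g₁.eval X obs c ω) (g₂.eval X obs c ω) :=
        funext fun x => by rw [TrajExpr.eval]
      rw [this]
      obtain ⟨h1, h2⟩ := TrajExpr.continuous_eval_and_mem X obs hc₀ hc₁ g₁
      obtain ⟨k1, k2⟩ := TrajExpr.continuous_eval_and_mem X obs hc₀ hc₁ g₂
      exact ⟨h1.min k1, fun ω => ⟨le_min (h2 ω).1 (k2 ω).1, min_le_of_left_le (h2 ω).2⟩⟩
  | .max g₁ g₂ => by
      have : TrajExpr.eval X obs c (.max g₁ g₂) =
          fun ω => max (g₁.eval X obs c ω) (g₂.eval X obs c ω) :=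
        funext fun x => by rw [TrajExpr.eval]
      rw [this]
      obtain ⟨h1, h2⟩ := TrajExpr.continuous_eval_and_mem X obs hc₀ hc₁ g₁
      obtain ⟨k1, k2⟩ := TrajExpr.continuous_eval_and_mem X obs hc₀ hc₁ g₂
      exact ⟨h1.max k1, fun ω => ⟨le_max_of_le_left (h2 ω).1, max_le (h2 ω).2 (k2 ω).2⟩⟩
  | .ominus g q => by
      have : TrajExpr.eval X obs c (.ominus g q) =
          fun ω => max 0 (g.eval X obs c ω - ((q : ℚ) : ℝ)) :=
        funext fun x => by rw [TrajExpr.eval]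
      rw [this]
      obtain ⟨h1, h2⟩ := TrajExpr.continuous_eval_and_mem X obs hc₀ hc₁ g
      have hq : (0 : ℝ) ≤ ((q : ℚ) : ℝ) := by exact_mod_cast q.2.1
      exact ⟨continuous_const.max (h1.sub continuous_const), fun ω =>
        ⟨le_max_left _ _, max_le zero_le_one (by linarith [h2 ω])⟩⟩
  | .oplus g q => by
      have : TrajExpr.eval X obs c (.oplus g q) =
          fun ω => min 1 (g.eval X obs c ω + ((q : ℚ) : ℝ)) :=
        funext fun x => by rw [TrajExpr.eval]
      rw [this]
      obtain ⟨h1, h2⟩ := TrajExpr.continuous_eval_and_mem X obs hc₀ hc₁ g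
      have hq : (0 : ℝ) ≤ ((q : ℚ) : ℝ) := by exact_mod_cast q.2.1
      exact ⟨continuous_const.min (h1.add continuous_const), fun ω =>
        ⟨le_min zero_le_one (by linarith [h2 ω]), min_le_left _ _⟩⟩

end

/-! ### The logical pseudometric -/

theorem abs_eval_sub_le_one (X : Diffusion E) (obs : C(E, I)) {c : ℝ} (hc₀ : 0 < c)
    (hc₁ : c < 1) (f : StateExpr) (x y : E) :
    |f.eval X obs c x - f.eval X obs c y| ≤ 1 := by
  have h := (f.continuous_eval_and_mem X obs hc₀ hc₁).2
  rw [abs_le]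
  constructor <;> linarith [h x, h y]

theorem abs_eval_sub_le_logicPseudometric (X : Diffusion E) (obs : C(E, I)) {c : ℝ} (hc₀ : 0 < c)
    (hc₁ : c < 1) (f : StateExpr) (x y : E) :
    |f.eval X obs c x - f.eval X obs c y| ≤ logicPseudometric X obs c x y :=
  le_ciSup (f := fun f : StateExpr => |f.eval X obs c x - f.eval X obs c y|)
    ⟨1, by rintro _ ⟨f, rfl⟩; exact abs_eval_sub_le_one X obs hc₀ hc₁ f x y⟩ f

theorem isLscPseudometric_logicPseudometric (X : Diffusion E) (obs : C(E, I)) {c : ℝ} (hc₀ : 0 < c)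
    (hc₁ : c < 1) :
    IsLscPseudometric (logicPseudometric X obs c) where
  nonneg x y := Real.iSup_nonneg fun _ => abs_nonneg _
  le_one x y := ciSup_le fun f => abs_eval_sub_le_one X obs hc₀ hc₁ f x y
  self x := by simp [logicPseudometric]
  symm x y := by simp only [logicPseudometric, abs_sub_comm]
  triangle x y z := ciSup_le fun f => (abs_sub_le _ (f.eval X obs c y) _).trans
    (add_le_add (abs_eval_sub_le_logicPseudometric X obs hc₀ hc₁ f x y)
      (abs_eval_sub_le_logicPseudometric X obs hc₀ hc₁ f y z))
  lsc := by
    refine lowerSemicontinuous_ciSup (fun p => ⟨1, ?_⟩) fun f => ?_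
    · rintro _ ⟨f, rfl⟩
      exact abs_eval_sub_le_one X obs hc₀ hc₁ f p.1 p.2
    · have h := (f.continuous_eval_and_mem X obs hc₀ hc₁).1
      exact ((h.comp continuous_fst).sub (h.comp continuous_snd)).abs.lowerSemicontinuous

end

/-! ### Attainment by compactness -/

theorem exists_coupling_integral_iSup_le {Ω : Type*} [TopologicalSpace Ω] [PolishSpace Ω]
    [MeasurableSpace Ω] [BorelSpace Ω] (μ ν : ProbabilityMeasure Ω) {k : ℕ → Ω × Ω → ℝ}
    (hk : ∀ n, Continuous (k n)) (hk01 : ∀ n x, 0 ≤ k n x ∧ k n x ≤ 1)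
    (hmono : ∀ x, Monotone fun n => k n x) {M : ℝ}
    (h : ∀ n, ∀ ε > 0, ∃ γ ∈ couplings (μ : Measure Ω) (ν : Measure Ω), ∫ x, k n x ∂γ ≤ M + ε) :
    ∃ γ ∈ couplings (μ : Measure Ω) (ν : Measure Ω), ∫ x, ⨆ n, k n x ∂γ ≤ M := by
  let C := {γ : ProbabilityMeasure (Ω × Ω) | (γ : Measure (Ω × Ω)) ∈
      couplings (μ : Measure Ω) (ν : Measure Ω)}
  have hC : IsCompact C := isCompact_couplings μ ν
  have hInt : ∀ (γ : Measure (Ω × Ω)) [IsProbabilityMeasure γ] (f : Ω × Ω → ℝ), Measurable f →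
      (∀ x, 0 ≤ f x ∧ f x ≤ 1) → Integrable f γ := fun γ _ f hf hf01 =>
    Integrable.of_bound hf.aestronglyMeasurable 1
      (ae_of_all _ fun x => by rw [Real.norm_eq_abs, abs_of_nonneg (hf01 x).1]; exact (hf01 x).2)
  have hcl : ∀ n, IsClosed (C ∩ {γ | ∫ x, k n x ∂(γ : Measure (Ω × Ω)) ≤ M + 1 / (n + 1)}) :=
    fun n => hC.isClosed.inter (isClosed_le
      (continuous_integral_probabilityMeasure (hk n) (hk01 n)) continuous_const)
  have hle : ∀ (γ : Measure (Ω × Ω)) [IsProbabilityMeasure γ] {m n : ℕ}, m ≤ n →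
      ∫ x, k m x ∂γ ≤ ∫ x, k n x ∂γ := fun γ _ m n hmn =>
    integral_mono (hInt γ _ (hk m).measurable (hk01 m)) (hInt γ _ (hk n).measurable (hk01 n))
      fun x => hmono x hmn
  obtain ⟨γ, hγ⟩ := IsCompact.nonempty_iInter_of_sequence_nonempty_isCompact_isClosed
    (fun n : ℕ => C ∩ {γ | ∫ x, k n x ∂(γ : Measure (Ω × Ω)) ≤ M + 1 / (n + 1)})
    (fun n γ hγ => by
      refine ⟨hγ.1, (hle (γ : Measure (Ω × Ω)) n.le_succ).trans (hγ.2.trans ?_)⟩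
      have := one_div_le_one_div_of_le (show (0 : ℝ) < n + 1 by positivity)
        (show (n : ℝ) + 1 ≤ ((n + 1 : ℕ) : ℝ) + 1 by push_cast; linarith)
      linarith)
    (fun n => by
      obtain ⟨γ, hγ, hγk⟩ := h n (1 / (n + 1)) (by positivity)
      exact ⟨⟨γ, hγ.1⟩, hγ, hγk⟩)
    (hC.inter_right (isClosed_le
      (continuous_integral_probabilityMeasure (hk 0) (hk01 0)) continuous_const)) hcl
  rw [mem_iInter] at hγ
  have hbdd : ∀ x, BddAbove (range fun n => k n x) := fun x =>
    ⟨1, by rintro _ ⟨n, rfl⟩; exact (hk01 n x).2⟩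
  have hγM : ∀ n, ∫ x, k n x ∂(γ : Measure (Ω × Ω)) ≤ M := by
    intro n
    have hlim : Tendsto (fun j : ℕ => M + 1 / ((j : ℝ) + 1)) atTop (𝓝 (M + 0)) :=
      tendsto_const_nhds.add tendsto_one_div_add_atTop_nhds_zero_nat
    rw [add_zero] at hlim
    refine ge_of_tendsto hlim ?_
    filter_upwards [eventually_ge_atTop n] with j hj
    exact (hle _ hj).trans (hγ j).2
  refine ⟨γ, (hγ 0).1, ?_⟩
  have hsup : Integrable (fun x => ⨆ n, k n x) (γ : Measure (Ω × Ω)) :=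
    hInt _ _ (Measurable.iSup fun n => (hk n).measurable) fun x =>
      ⟨Real.iSup_nonneg fun n => (hk01 n x).1, ciSup_le fun n => (hk01 n x).2⟩
  exact le_of_tendsto' (integral_tendsto_of_tendsto_of_monotone
    (fun n => hInt _ _ (hk n).measurable (hk01 n)) hsup (ae_of_all _ hmono)
    (ae_of_all _ fun x => tendsto_atTop_ciSup (hmono x) (hbdd x))) hγM

section

variable {E : Type*} [TopologicalSpace E] [LocallyCompactSpace E] [T2Space E]
  [SecondCountableTopology E] [MeasurableSpace E] [BorelSpace E]

theorem Diffusion.ae_eval_zero (X : Diffusion E) (x : E) :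
    ∀ᵐ ω ∂(X.law x : Measure (Trajectory E)), ω 0 = x := by
  have h := X.law_cylinder x {x} [] (measurableSet_singleton x) (by simp) (by simp)
  have hm : MeasurableSet {ω : Trajectory E | ω 0 = x} :=
    measurable_coord 0 (measurableSet_singleton x)
  refine (mem_ae_iff_prob_eq_one hm).2 ?_
  simpa [cylinderMass] using h

theorem denseRange_nnratCast : DenseRange (fun q : ℚ≥0 => (q : ℝ≥0)) := by
  refine dense_of_exists_between fun {a b} hab => ?_
  obtain ⟨q, hq, h1, h2⟩ := (NNReal.lt_iff_exists_rat_btwn a b).1 hab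
  lift q to ℚ≥0 using hq
  have : (q : ℝ≥0) = Real.toNNReal ((q : ℚ) : ℝ) := by
    ext
    rw [Real.coe_toNNReal _ (by exact_mod_cast q.2)]
    rfl
  exact ⟨_, ⟨q, rfl⟩, h1.trans_eq this.symm, this.trans_lt h2⟩

/-! ### The cost as a countable supremum -/

theorem TrajExpr.eval_ev (X : Diffusion E) (obs : C(E, I)) (c : ℝ) (f : StateExpr) (t : ℚ≥0)
    (ω : Trajectory E) :
    (TrajExpr.ev f t).eval X obs c ω = c ^ (t : ℝ) * f.eval X obs c (ω (t : ℝ≥0)) := by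
  rw [TrajExpr.eval]

/-- The vector of values on a trajectory of the first `n + 1` expressions `f ∘ ev_t` in an
enumeration `e`. -/
noncomputable def evVector (X : Diffusion E) (obs : C(E, I)) (c : ℝ) (e : ℕ → StateExpr × ℚ≥0)
    (n : ℕ) (ω : Trajectory E) (i : Fin (n + 1)) : ℝ :=
  (TrajExpr.ev (e i).1 (e i).2).eval X obs c ω

theorem continuous_evVector (X : Diffusion E) (obs : C(E, I)) {c : ℝ} (hc₀ : 0 < c)
    (hc₁ : c < 1) (e : ℕ → StateExpr × ℚ≥0) (n : ℕ) : Continuous (evVector X obs c e n) :=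
  continuous_pi fun _ => (TrajExpr.continuous_eval_and_mem X obs hc₀ hc₁ _).1

theorem evVector_mem (X : Diffusion E) (obs : C(E, I)) {c : ℝ} (hc₀ : 0 < c)
    (hc₁ : c < 1) (e : ℕ → StateExpr × ℚ≥0) (n : ℕ) (ω : Trajectory E) (i : Fin (n + 1)) :
    0 ≤ evVector X obs c e n ω i ∧ evVector X obs c e n ω i ≤ 1 :=
  (TrajExpr.continuous_eval_and_mem X obs hc₀ hc₁ _).2 ω

theorem dist_evVector_le_one (X : Diffusion E) (obs : C(E, I)) {c : ℝ} (hc₀ : 0 < c)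
    (hc₁ : c < 1) (e : ℕ → StateExpr × ℚ≥0) (n : ℕ) (ω ω' : Trajectory E) :
    dist (evVector X obs c e n ω) (evVector X obs c e n ω') ≤ 1 :=
  (dist_pi_le_iff zero_le_one).2 fun i => by
    have h := evVector_mem X obs hc₀ hc₁ e n ω i
    have h' := evVector_mem X obs hc₀ hc₁ e n ω' i
    rw [Real.dist_eq, abs_le]
    constructor <;> linarith

theorem monotone_dist_evVector (X : Diffusion E) (obs : C(E, I)) (c : ℝ)
    (e : ℕ → StateExpr × ℚ≥0) (ω ω' : Trajectory E) :
    Monotone fun n => dist (evVector X obs c e n ω) (evVector X obs c e n ω') := by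
  intro m n hmn
  refine (dist_pi_le_iff dist_nonneg).2 fun i => ?_
  exact dist_le_pi_dist (evVector X obs c e n ω) (evVector X obs c e n ω')
    (Fin.castLE (Nat.succ_le_succ hmn) i)

theorem le_discountedUniform {E : Type*} [TopologicalSpace E] {c : ℝ} (hc₀ : 0 < c)
    (hc₁ : c < 1) {m : E → E → ℝ} (hm : IsLscPseudometric m) (ω ω' : Trajectory E) (t : ℝ≥0) :
    c ^ (t : ℝ) * m (ω t) (ω' t) ≤ discountedUniform c m ω ω' := by
  refine le_ciSup (f := fun t : ℝ≥0 => c ^ (t : ℝ) * m (ω t) (ω' t)) ⟨1, ?_⟩ t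
  rintro _ ⟨s, rfl⟩
  have hs := pow_mem_unitInterval hc₀ hc₁ s
  exact mul_le_one₀ hs.2 (hm.nonneg _ _) (hm.le_one _ _)

theorem discountedUniform_logicPseudometric_eq_iSup (X : Diffusion E) (obs : C(E, I)) {c : ℝ}
    (hc₀ : 0 < c) (hc₁ : c < 1) {e : ℕ → StateExpr × ℚ≥0} (he : Function.Surjective e)
    (ω ω' : Trajectory E) :
    discountedUniform c (logicPseudometric X obs c) ω ω' =
      ⨆ n, dist (evVector X obs c e n ω) (evVector X obs c e n ω') := by
  have hL := isLscPseudometric_logicPseudometric X obs hc₀ hc₁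
  have hbdd : BddAbove (range fun n => dist (evVector X obs c e n ω) (evVector X obs c e n ω')) :=
    ⟨1, by rintro _ ⟨n, rfl⟩; exact dist_evVector_le_one X obs hc₀ hc₁ e n ω ω'⟩
  apply le_antisymm
  · refine ciSup_le fun t => ?_
    have hpos : 0 < c ^ (t : ℝ) := Real.rpow_pos_of_pos hc₀ _
    rw [logicPseudometric, Real.mul_iSup_of_nonneg hpos.le]
    refine ciSup_le fun f => ?_
    have hf := (f.continuous_eval_and_mem X obs hc₀ hc₁).1
    have hcont : Continuous fun s : ℝ≥0 =>
        c ^ (s : ℝ) * |f.eval X obs c (ω s) - f.eval X obs c (ω' s)| :=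
      (continuous_const.rpow NNReal.continuous_coe fun _ => .inl hc₀.ne').mul
        ((hf.comp ω.continuous).sub (hf.comp ω'.continuous)).abs
    refine denseRange_nnratCast.induction_on (p := fun s : ℝ≥0 =>
      c ^ (s : ℝ) * |f.eval X obs c (ω s) - f.eval X obs c (ω' s)| ≤
        ⨆ n, dist (evVector X obs c e n ω) (evVector X obs c e n ω')) t
      (isClosed_le hcont continuous_const) fun q => ?_
    obtain ⟨n, hn⟩ := he (f, q)
    refine le_trans ?_ (le_ciSup hbdd n)
    refine le_trans (le_of_eq ?_) (dist_le_pi_dist _ _ (Fin.last n))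
    have hq : 0 < c ^ (q : ℝ) := Real.rpow_pos_of_pos hc₀ _
    simp only [evVector, Fin.val_last, hn, TrajExpr.eval_ev]
    rw [Real.dist_eq, ← mul_sub, abs_mul, abs_of_pos hq]
    rfl
  · refine ciSup_le fun n => (dist_pi_le_iff ?_).2 fun i => ?_
    · exact Real.iSup_nonneg fun t =>
        mul_nonneg (Real.rpow_pos_of_pos hc₀ _).le (hL.nonneg _ _)
    · refine le_trans ?_ (le_discountedUniform hc₀ hc₁ hL ω ω' ((e i).2 : ℝ≥0))
      have hq : 0 < c ^ ((e i).2 : ℝ) := Real.rpow_pos_of_pos hc₀ _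
      simp only [evVector, TrajExpr.eval_ev]
      rw [Real.dist_eq, ← mul_sub, abs_mul, abs_of_pos hq]
      exact mul_le_mul_of_nonneg_left
        (abs_eval_sub_le_logicPseudometric X obs hc₀ hc₁ (e i).1 _ _) hq.le

theorem exists_surjective_expr : ∃ e : ℕ → StateExpr × ℚ≥0, Function.Surjective e :=
  exists_surjective_nat _

theorem measurable_discountedUniform (X : Diffusion E) (obs : C(E, I)) {c : ℝ}
    (hc₀ : 0 < c) (hc₁ : c < 1) :
    Measurable fun p : Trajectory E × Trajectory E =>
      discountedUniform c (logicPseudometric X obs c) p.1 p.2 := by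
  obtain ⟨e, he⟩ := exists_surjective_expr
  simp only [discountedUniform_logicPseudometric_eq_iSup X obs hc₀ hc₁ he]
  have h := fun n => (continuous_evVector X obs hc₀ hc₁ e n).measurable
  exact Measurable.iSup fun n => ((h n).comp measurable_fst).dist ((h n).comp measurable_snd)

/-! ### The fixpoint property -/

theorem logicPseudometric_le_integral (X : Diffusion E) (obs : C(E, I)) {c : ℝ}
    (hc₀ : 0 < c) (hc₁ : c < 1) (x y : E) {γ : Measure (Trajectory E × Trajectory E)}
    (hγ : γ ∈ couplings (X.law x : Measure (Trajectory E)) (X.law y)) :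
    logicPseudometric X obs c x y ≤
      ∫ p, discountedUniform c (logicPseudometric X obs c) p.1 p.2 ∂γ := by
  obtain ⟨_, h1, h2⟩ := hγ
  have hL := isLscPseudometric_logicPseudometric X obs hc₀ hc₁
  have hx : ∀ᵐ p ∂γ, p.1 0 = x := by
    refine ae_of_ae_map (p := fun ω : Trajectory E => ω 0 = x) measurable_fst.aemeasurable ?_
    rw [h1]; exact X.ae_eval_zero x
  have hy : ∀ᵐ p ∂γ, p.2 0 = y := by
    refine ae_of_ae_map (p := fun ω : Trajectory E => ω 0 = y) measurable_snd.aemeasurable ?_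
    rw [h2]; exact X.ae_eval_zero y
  have hInt : Integrable (fun p : Trajectory E × Trajectory E =>
      discountedUniform c (logicPseudometric X obs c) p.1 p.2) γ := by
    refine Integrable.of_bound
      (measurable_discountedUniform X obs hc₀ hc₁).aestronglyMeasurable 1 (ae_of_all _ fun p => ?_)
    have h0 : 0 ≤ discountedUniform c (logicPseudometric X obs c) p.1 p.2 :=
      Real.iSup_nonneg fun t => mul_nonneg (Real.rpow_pos_of_pos hc₀ _).le (hL.nonneg _ _)
    rw [Real.norm_eq_abs, abs_of_nonneg h0]
    exact ciSup_le fun t => mul_le_one₀ (pow_mem_unitInterval hc₀ hc₁ t).2 (hL.nonneg _ _)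
      (hL.le_one _ _)
  calc logicPseudometric X obs c x y = ∫ _, logicPseudometric X obs c x y ∂γ := by simp
    _ ≤ _ := by
      refine integral_mono_ae (integrable_const _) hInt ?_
      filter_upwards [hx, hy] with p hpx hpy
      simpa [hpx, hpy] using le_discountedUniform hc₀ hc₁ hL p.1 p.2 0

theorem isClosedUnderConnectives_lipschitz (X : Diffusion E) (obs : C(E, I)) (c : ℝ)
    (k : Trajectory E → Trajectory E → ℝ) (hk : ∀ ω ω', 0 ≤ k ω ω') :
    IsClosedUnderConnectives {h : Trajectory E → ℝ | (∃ g : TrajExpr, g.eval X obs c = h) ∧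
      ∀ ω ω', h ω - h ω' ≤ k ω ω'} where
  inf := by
    rintro _ ⟨⟨f, rfl⟩, hf⟩ _ ⟨⟨g, rfl⟩, hg⟩
    refine ⟨⟨.min f g, funext fun ω => by rw [TrajExpr.eval]; rfl⟩, fun ω ω' => ?_⟩
    have := hf ω ω'; have := hg ω ω'
    simp only [Pi.inf_apply]
    grind
  sup := by
    rintro _ ⟨⟨f, rfl⟩, hf⟩ _ ⟨⟨g, rfl⟩, hg⟩
    refine ⟨⟨.max f g, funext fun ω => by rw [TrajExpr.eval]; rfl⟩, fun ω ω' => ?_⟩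
    have := hf ω ω'; have := hg ω ω'
    simp only [Pi.sup_apply]
    grind
  ominus := by
    rintro _ ⟨⟨f, rfl⟩, hf⟩ q
    refine ⟨⟨.ominus f q, funext fun ω => by rw [TrajExpr.eval]⟩, fun ω ω' => ?_⟩
    have := hf ω ω'; have := hk ω ω'
    grind
  oplus := by
    rintro _ ⟨⟨f, rfl⟩, hf⟩ q
    refine ⟨⟨.oplus f q, funext fun ω => by rw [TrajExpr.eval]⟩, fun ω ω' => ?_⟩
    have := hf ω ω'; have := hk ω ω'
    grind

theorem exists_trajExpr_eval_sub_eq_dist (X : Diffusion E) (obs : C(E, I)) (c : ℝ)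
    (e : ℕ → StateExpr × ℚ≥0) (n : ℕ) (ω ω' : Trajectory E) :
    ∃ g : TrajExpr, (∀ η η', g.eval X obs c η - g.eval X obs c η' ≤
      dist (evVector X obs c e n η) (evVector X obs c e n η')) ∧
      dist (evVector X obs c e n ω) (evVector X obs c e n ω') ≤
        g.eval X obs c ω - g.eval X obs c ω' := by
  obtain ⟨i, hi⟩ := Finite.exists_max
    fun i => dist (evVector X obs c e n ω i) (evVector X obs c e n ω' i)
  have hd : dist (evVector X obs c e n ω) (evVector X obs c e n ω') ≤
      |evVector X obs c e n ω i - evVector X obs c e n ω' i| :=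
    (dist_pi_le_iff (abs_nonneg _)).2 hi
  have hl : ∀ η η', |evVector X obs c e n η i - evVector X obs c e n η' i| ≤
      dist (evVector X obs c e n η) (evVector X obs c e n η') := fun η η' =>
    dist_le_pi_dist (evVector X obs c e n η) (evVector X obs c e n η') i
  have hflip : ∀ η η', (TrajExpr.ev (.oneSub (e i).1) (e i).2).eval X obs c η -
      (TrajExpr.ev (.oneSub (e i).1) (e i).2).eval X obs c η' =
      -(evVector X obs c e n η i - evVector X obs c e n η' i) := by
    intro η η'
    simp only [evVector, TrajExpr.eval_ev, StateExpr.eval]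
    ring
  rcases le_total 0 (evVector X obs c e n ω i - evVector X obs c e n ω' i) with h | h
  · rw [abs_of_nonneg h] at hd
    exact ⟨.ev (e i).1 (e i).2, fun η η' => (le_abs_self _).trans (hl η η'), hd⟩
  · rw [abs_of_nonpos h] at hd
    refine ⟨.ev (.oneSub (e i).1) (e i).2, fun η η' => ?_, ?_⟩
    · rw [hflip]; exact (neg_le_abs _).trans (hl η η')
    · rw [hflip]; exact hd

theorem exists_coupling_integral_le_logicPseudometric (X : Diffusion E) (obs : C(E, I)) {c : ℝ}
    (hc₀ : 0 < c) (hc₁ : c < 1) (x y : E) :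
    ∃ γ ∈ couplings (X.law x : Measure (Trajectory E)) (X.law y : Measure (Trajectory E)),
      ∫ p, discountedUniform c (logicPseudometric X obs c) p.1 p.2 ∂γ ≤
        logicPseudometric X obs c x y := by
  obtain ⟨e, he⟩ := exists_surjective_expr
  have := polishSpace_trajectory E
  simp only [discountedUniform_logicPseudometric_eq_iSup X obs hc₀ hc₁ he]
  have hG := continuous_evVector X obs hc₀ hc₁ e
  refine exists_coupling_integral_iSup_le (X.law x) (X.law y)
    (k := fun n p => dist (evVector X obs c e n p.1) (evVector X obs c e n p.2))
    (fun n => ((hG n).comp continuous_fst).dist ((hG n).comp continuous_snd))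
    (fun n p => ⟨dist_nonneg, dist_evVector_le_one X obs hc₀ hc₁ e n _ _⟩)
    (fun p => monotone_dist_evVector X obs c e p.1 p.2) fun n ε hε => ?_
  refine exists_coupling_integral_dist_le _ _ (hG n).measurable
    (evVector_mem X obs hc₀ hc₁ e n)
    (isClosedUnderConnectives_lipschitz X obs c _ fun ω ω' => dist_nonneg) ?_ ?_
    (fun g hg => hg.2) ?_ ?_ hε
  · rintro _ ⟨⟨g, rfl⟩, -⟩
    exact (g.continuous_eval_and_mem X obs hc₀ hc₁).1.measurable
  · rintro _ ⟨⟨g, rfl⟩, -⟩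
    exact (g.continuous_eval_and_mem X obs hc₀ hc₁).2
  · intro ω ω'
    obtain ⟨g, hg, hgd⟩ := exists_trajExpr_eval_sub_eq_dist X obs c e n ω ω'
    exact ⟨_, ⟨⟨g, rfl⟩, hg⟩, hgd⟩
  · rintro _ ⟨⟨g, rfl⟩, -⟩
    have := abs_eval_sub_le_logicPseudometric X obs hc₀ hc₁ (.integral g) x y
    simp only [StateExpr.eval] at this
    exact (le_abs_self _).trans this

end

end DiffusionLogic

theorem mainTheorem3 {E : Type*} [TopologicalSpace E] [LocallyCompactSpace E] [T2Space E]
    [SecondCountableTopology E] [MeasurableSpace E] [BorelSpace E]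
    (X : DiffusionLogic.Diffusion E) (obs : C(E, unitInterval)) (c : ℝ) (hc₀ : 0 < c)
    (hc₁ : c < 1) :
    DiffusionLogic.IsLscPseudometric (DiffusionLogic.logicPseudometric X obs c) ∧
    X.functional c (DiffusionLogic.logicPseudometric X obs c) =
      DiffusionLogic.logicPseudometric X obs c ∧
    ∀ x y : E, ∃ γ ∈ DiffusionLogic.couplings (X.law x : Measure (DiffusionLogic.Trajectory E))
        (X.law y : Measure (DiffusionLogic.Trajectory E)),
      ∫ p, DiffusionLogic.discountedUniform c (DiffusionLogic.logicPseudometric X obs c)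
        p.1 p.2 ∂γ = X.functional c (DiffusionLogic.logicPseudometric X obs c) x y := by
  have hle := fun x y γ hγ =>
    DiffusionLogic.logicPseudometric_le_integral X obs hc₀ hc₁ x y (γ := γ) hγ
  have hex := DiffusionLogic.exists_coupling_integral_le_logicPseudometric X obs hc₀ hc₁
  have hfix : X.functional c (DiffusionLogic.logicPseudometric X obs c) =
      DiffusionLogic.logicPseudometric X obs c := by
    funext x y
    obtain ⟨γ, hγ, hγle⟩ := hex x y
    apply le_antisymm
    · refine (csInf_le (⟨DiffusionLogic.logicPseudometric X obs c x y, ?_⟩ : BddBelow _)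
        (mem_image_of_mem _ hγ)).trans hγle
      rintro _ ⟨γ', hγ', rfl⟩
      exact hle x y γ' hγ'
    · refine le_csInf ((nonempty_of_mem hγ).image _) ?_
      rintro _ ⟨γ', hγ', rfl⟩
      exact hle x y γ' hγ'
  refine ⟨DiffusionLogic.isLscPseudometric_logicPseudometric X obs hc₀ hc₁, hfix, fun x y => ?_⟩
  obtain ⟨γ, hγ, hγle⟩ := hex x y
  exact ⟨γ, hγ, by rw [hfix]; exact le_antisymm hγle (hle x y γ hγ)⟩
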